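/- **Theorem 1.9.** Let $x_i, x_i^*, y_{i,1}, y_{i,2}$ ($1\le i\le 3$), $y_{4,1}, y_{4,2}$ be coordinates on $\mathbb{R}^{14}$, and let $a_{i,j}$ ($1\le i\le 3$, $1\le j\le 2$) be arbitrary real constants. Let $g_A$ be the pseudo-Riemannian metric on $\mathbb{R}^{14}$ whose non-zero components are, up to the symmetry $g_A(X,Y)=g_A(Y,X)$, $$\begin{aligned} &g_A(\partial_{x_i},\partial_{x_i^*})=g_A(\partial_{y_{i,1}},\partial_{y_{i,2}})=1\quad(1\le i\le 3),\\ &g_A(\partial_{y_{4,1}},\partial_{y_{4,1}})=g_A(\partial_{y_{4,2}},\partial_{y_{4,2}})=-\tfrac12,\qquad g_A(\partial_{y_{4,1}},\partial_{y_{4,2}})=\tfrac14,\\ &g_A(\partial_{x_1},\partial_{x_1})=-2a_{2,1}x_2y_{2,1}-2a_{3,1}x_3y_{3,1},\\ &g_A(\partial_{x_2},\partial_{x_2})=-2a_{3,2}x_3y_{3,2}-2a_{1,2}x_1y_{1,2},\\ &g_A(\partial_{x_3},\partial_{x_3})=-2a_{1,1}x_1y_{1,1}-2a_{2,2}x_2y_{2,2},\\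 &g_A(\partial_{x_1},\partial_{x_2})=2(1-a_{2,1})x_1y_{2,1}+2(1-a_{1,2})x_2y_{1,2},\\ &g_A(\partial_{x_2},\partial_{x_3})=x_1y_{4,1}+2(1-a_{3,2})x_2y_{3,2}+2(1-a_{2,2})x_3y_{2,2},\\ &g_A(\partial_{x_1},\partial_{x_3})=x_2y_{4,2}+2(1-a_{3,1})x_1y_{3,1}+2(1-a_{1,1})x_3y_{1,1}. \end{aligned}$$ Let $\nabla$ be its Levi-Civita connection, $\mathcal R(X,Y)=\nabla_X\nabla_Y-\nabla_Y\nabla_X-\nabla_{[X,Y]}$ and $R(X,Y,Z,W)=g_A(\mathcal R(X,Y)Z,W)$. A $0$-model $(V,\langle\cdot,\cdot\rangle,A)$ is a finite-dimensional real vector space with a non-degenerate symmetric bilinear form and a $4$-tensor $A$ satisfying $A(x,y,z,w)=-A(y,x,z,w)=A(z,w,x,y)$ and $A(x,y,z,w)+A(y,z,x,w)+A(z,x,y,w)=0$. Let $\mathfrak M_{14}=(\mathbb{R}^{14},\langle\cdot,\cdot\rangle,A)$ be the $0$-model with basis $\alpha_i,\alpha_i^*,\beta_{i,1},\beta_{i,2}$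 ($1\le i\le3$), $\beta_{4,1},\beta_{4,2}$ whose non-zero components are, up to the symmetry of $\langle\cdot,\cdot\rangle$ and the symmetries $A(x,y,z,w)=-A(y,x,z,w)=A(z,w,x,y)$, $$\begin{aligned} &\langle\alpha_i,\alpha_i^*\rangle=\langle\beta_{i,1},\beta_{i,2}\rangle=1\quad(1\le i\le3),\\ &\langle\beta_{4,1},\beta_{4,1}\rangle=\langle\beta_{4,2},\beta_{4,2}\rangle=-\tfrac12,\qquad\langle\beta_{4,1},\beta_{4,2}\rangle=\tfrac14,\\ &A(\alpha_2,\alpha_1,\alpha_1,\beta_{2,1})=A(\alpha_3,\alpha_1,\alpha_1,\beta_{3,1})=1,\\ &A(\alpha_3,\alpha_2,\alpha_2,\beta_{3,2})=A(\alpha_1,\alpha_2,\alpha_2,\beta_{1,2})=1,\\ &A(\alpha_1,\alpha_3,\alpha_3,\beta_{1,1})=A(\alpha_2,\alpha_3,\alpha_3,\beta_{2,2})=1,\\ &A(\alpha_1,\alpha_2,\alpha_3,\beta_{4,1})=A(\alpha_1,\alpha_3,\alpha_2,\beta_{4,1})=-\tfrac12,\\ &A(\alpha_2,\alpha_3,\alpha_1,\beta_{4,2})=A(\alpha_2,\alpha_1,\alpha_3,\beta_{4,2})=-\tfrac12.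 \end{aligned}$$ Then $(\mathbb{R}^{14},g_A)$ has $0$-model $\mathfrak M_{14}$: for every $P\in\mathbb{R}^{14}$ there is a linear isomorphism $\Theta_P:T_P\mathbb{R}^{14}\to\mathbb{R}^{14}$ with $\Theta_P^*\langle\cdot,\cdot\rangle=(g_A)_P$ and $\Theta_P^*A=R_P$. Furthermore, $(\mathbb{R}^{14},g_A)$ is locally symmetric, i.e. $\nabla R=0$ everywhere, if and only if all three of the following conditions hold: 1. $a_{1,1}+a_{2,2}+a_{3,1}a_{3,2}=2$; 2. $3a_{2,1}+3a_{3,1}+3a_{1,2}a_{1,1}=4$; 3. $3a_{1,2}+3a_{3,2}+3a_{2,1}a_{2,2}=4$. -/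

import Mathlib

open scoped ContDiff

noncomputable section

/-- A `0`-model on the real vector space `V`: a non-degenerate symmetric bilinear form together with
an algebraic curvature tensor. -/
structure ZeroModel (V : Type*) [AddCommGroup V] [Module ℝ V] where
  inner : V →ₗ[ℝ] V →ₗ[ℝ] ℝ
  curv : V →ₗ[ℝ] V →ₗ[ℝ] V →ₗ[ℝ] V →ₗ[ℝ] ℝ
  inner_symm : ∀ x y, inner x y = inner y x
  inner_nondeg : ∀ x, (∀ y, inner x y = 0) → x = 0
  curv_antisymm : ∀ x y z w, curv x y z w = -curv y x z w
  curv_pair_symm : ∀ x y z w, curv x y z w = curv z w x y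
  curv_bianchi : ∀ x y z w, curv x y z w + curv y z x w + curv z x y w = 0

/-- A smooth pseudo-Riemannian metric on `ℝ^ι`, given by its component matrix
`g_{ij} = g(∂_i, ∂_j)` in the standard global coordinates. -/
structure PseudoRiemannianMetric (ι : Type*) [Fintype ι] [DecidableEq ι] where
  comp : (ι → ℝ) → Matrix ι ι ℝ
  symm : ∀ p i j, comp p i j = comp p j i
  det_ne_zero : ∀ p, (comp p).det ≠ 0
  smooth : ∀ i j, ContDiff ℝ ∞ fun p => comp p i j

/-- The `i`-th partial derivative of `f` at `p`. -/
def partialD {ι : Type*} [Fintype ι] [DecidableEq ι] (i : ι) (f : (ι → ℝ) → ℝ) (p : ι → ℝ) : ℝ :=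
  fderiv ℝ f p (Pi.single i 1)

namespace PseudoRiemannianMetric

variable {ι : Type*} [Fintype ι] [DecidableEq ι] (g : PseudoRiemannianMetric ι)

/-- The Christoffel symbol `Γ_{ij}^k` of the Levi-Civita connection:
`∇_{∂_i} ∂_j = ∑_k Γ_{ij}^k ∂_k`. -/
def christoffel (p : ι → ℝ) (i j k : ι) : ℝ :=
  ∑ l, (g.comp p)⁻¹ k l * ((partialD i (fun q => g.comp q j l) p
    + partialD j (fun q => g.comp q i l) p - partialD l (fun q => g.comp q i j) p) / 2)

/-- The components of the curvature operator
`R(X, Y) = ∇_X ∇_Y - ∇_Y ∇_X - ∇_{[X, Y]}`: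
`R(∂_i, ∂_j) ∂_k = ∑_l (curvOp p i j k l) ∂_l`. -/
def curvOp (p : ι → ℝ) (i j k l : ι) : ℝ :=
  partialD i (fun q => g.christoffel q j k l) p - partialD j (fun q => g.christoffel q i k l) p
    + ∑ m, (g.christoffel p j k m * g.christoffel p i m l
      - g.christoffel p i k m * g.christoffel p j m l)

/-- The components `R_{ijkl} = g(R(∂_i, ∂_j) ∂_k, ∂_l)` of the curvature tensor. -/
def curvComp (p : ι → ℝ) (i j k l : ι) : ℝ :=
  ∑ m, g.curvOp p i j k m * g.comp p m l

/-- The components `(∇_{∂_m} R)(∂_i, ∂_j, ∂_k, ∂_l)` of the covariant derivative of the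
curvature tensor. -/
def nablaCurvComp (p : ι → ℝ) (i j k l m : ι) : ℝ :=
  partialD m (fun q => g.curvComp q i j k l) p
    - ∑ r, (g.christoffel p m i r * g.curvComp p r j k l
      + g.christoffel p m j r * g.curvComp p i r k l
      + g.christoffel p m k r * g.curvComp p i j r l
      + g.christoffel p m l r * g.curvComp p i j k r)

/-- The metric `g_p` on the tangent space `T_p ℝ^ι = ℝ^ι`. -/
def metricAt (p u v : ι → ℝ) : ℝ :=
  ∑ i, ∑ j, g.comp p i j * u i * v j

/-- The curvature tensor `R_p` on the tangent space `T_p ℝ^ι = ℝ^ι`. -/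
def curvAt (p u v w z : ι → ℝ) : ℝ :=
  ∑ i, ∑ j, ∑ k, ∑ l, g.curvComp p i j k l * u i * v j * w k * z l

/-- The manifold `(ℝ^ι, g)` has `0`-model `M`: at every point `p` there is a linear isomorphism from
the tangent space to `V` that pulls the form and the tensor of `M` back to `g_p` and `R_p`. -/
def HasZeroModel {V : Type*} [AddCommGroup V] [Module ℝ V] (M : ZeroModel V) : Prop :=
  ∀ p : ι → ℝ, ∃ Θ : (ι → ℝ) ≃ₗ[ℝ] V,
    (∀ u v, M.inner (Θ u) (Θ v) = g.metricAt p u v) ∧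
    (∀ u v w z, M.curv (Θ u) (Θ v) (Θ w) (Θ z) = g.curvAt p u v w z)

/-- `(ℝ^ι, g)` is locally symmetric: `∇R = 0`. -/
def IsLocallySymmetric : Prop :=
  ∀ (p : ι → ℝ) (i j k l m : ι), g.nablaCurvComp p i j k l m = 0

end PseudoRiemannianMetric

/-- Labels for the `14` coordinates `x_i, x_i^*, y_{i,1}, y_{i,2}, y_{4,1}, y_{4,2}`
(`1 ≤ i ≤ 3`) on `ℝ^14`. -/
inductive Coord : Type
  | x1 | x2 | x3
  | xs1 | xs2 | xs3
  | y11 | y12 | y21 | y22 | y31 | y32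
  | y41 | y42
  deriving DecidableEq

instance : Fintype Coord where
  elems := {.x1, .x2, .x3, .xs1, .xs2, .xs3, .y11, .y12, .y21, .y22, .y31, .y32, .y41, .y42}
  complete c := by cases c <;> decide

theorem Coord.sum_eq (f : Coord → ℝ) :
    ∑ c, f c = f .x1 + f .x2 + f .x3 + f .xs1 + f .xs2 + f .xs3 + f .y11 + f .y12 + f .y21 + f .y22
      + f .y31 + f .y32 + f .y41 + f .y42 := by
  have h : (Finset.univ : Finset Coord) = {.x1, .x2, .x3, .xs1, .xs2, .xs3, .y11, .y12, .y21, .y22,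
      .y31, .y32, .y41, .y42} := rfl
  rw [h]
  repeat rw [Finset.sum_insert (by decide)]
  rw [Finset.sum_singleton]
  ring

/-- The components of the metric `g_A`. -/
def metricMatrix (a₁₁ a₁₂ a₂₁ a₂₂ a₃₁ a₃₂ : ℝ) (p : Coord → ℝ) : Matrix Coord Coord ℝ
  | .x1, .xs1 | .xs1, .x1 | .x2, .xs2 | .xs2, .x2 | .x3, .xs3 | .xs3, .x3 => 1
  | .y11, .y12 | .y12, .y11 | .y21, .y22 | .y22, .y21 | .y31, .y32 | .y32, .y31 => 1
  | .y41, .y41 | .y42, .y42 => -1 / 2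
  | .y41, .y42 | .y42, .y41 => 1 / 4
  | .x1, .x1 => -2 * a₂₁ * p .x2 * p .y21 - 2 * a₃₁ * p .x3 * p .y31
  | .x2, .x2 => -2 * a₃₂ * p .x3 * p .y32 - 2 * a₁₂ * p .x1 * p .y12
  | .x3, .x3 => -2 * a₁₁ * p .x1 * p .y11 - 2 * a₂₂ * p .x2 * p .y22
  | .x1, .x2 | .x2, .x1 => 2 * (1 - a₂₁) * p .x1 * p .y21 + 2 * (1 - a₁₂) * p .x2 * p .y12
  | .x2, .x3 | .x3, .x2 =>
      p .x1 * p .y41 + 2 * (1 - a₃₂) * p .x2 * p .y32 + 2 * (1 - a₂₂) * p .x3 * p .y22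
  | .x1, .x3 | .x3, .x1 =>
      p .x2 * p .y42 + 2 * (1 - a₃₁) * p .x1 * p .y31 + 2 * (1 - a₁₁) * p .x3 * p .y11
  | _, _ => 0

theorem metricMatrix_det_ne_zero (a₁₁ a₁₂ a₂₁ a₂₂ a₃₁ a₃₂ : ℝ) (p : Coord → ℝ) :
    (metricMatrix a₁₁ a₁₂ a₂₁ a₂₂ a₃₁ a₃₂ p).det ≠ 0 := by
  intro h
  obtain ⟨v, hv, h0⟩ := Matrix.exists_mulVec_eq_zero_iff.mpr h
  apply hv
  have key : ∀ c, ∑ d, metricMatrix a₁₁ a₁₂ a₂₁ a₂₂ a₃₁ a₃₂ p c d * v d = 0 :=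
    fun c => congrFun h0 c
  simp only [Coord.sum_eq] at key
  have e4 := key .xs1
  have e5 := key .xs2
  have e6 := key .xs3
  have e7 := key .y11
  have e8 := key .y12
  have e9 := key .y21
  have e10 := key .y22
  have e11 := key .y31
  have e12 := key .y32
  have e13 := key .y41
  have e14 := key .y42
  have e1 := key .x1
  have e2 := key .x2
  have e3 := key .x3
  simp only [metricMatrix, zero_mul, one_mul, add_zero, zero_add]
    at e4 e5 e6 e7 e8 e9 e10 e11 e12 e13 e14
  have f13 : v .y41 = 0 := by linarith
  have f14 : v .y42 = 0 := by linarith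
  simp only [metricMatrix, zero_mul, one_mul, add_zero, zero_add, e4, e5, e6, mul_zero] at e1 e2 e3
  funext c
  cases c <;> simp only [Pi.zero_apply] <;> assumption

/-- The pseudo-Riemannian metric `g_A` on `ℝ^14`. -/
def metricA (a₁₁ a₁₂ a₂₁ a₂₂ a₃₁ a₃₂ : ℝ) : PseudoRiemannianMetric Coord where
  comp := metricMatrix a₁₁ a₁₂ a₂₁ a₂₂ a₃₁ a₃₂
  symm p i j := by cases i <;> cases j <;> rfl
  det_ne_zero := metricMatrix_det_ne_zero a₁₁ a₁₂ a₂₁ a₂₂ a₃₁ a₃₂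
  smooth i j := by cases i <;> cases j <;> simp only [metricMatrix] <;> fun_prop

/-- The exterior product `e^a ∧ e^b` of two coordinate functionals:
`(x, y) ↦ x_a y_b - x_b y_a`. -/
def wedge (a b : Coord) : (Coord → ℝ) →ₗ[ℝ] (Coord → ℝ) →ₗ[ℝ] ℝ :=
  LinearMap.smulRight (LinearMap.proj a : (Coord → ℝ) →ₗ[ℝ] ℝ)
      (LinearMap.proj b : (Coord → ℝ) →ₗ[ℝ] ℝ)
    - LinearMap.smulRight (LinearMap.proj b : (Coord → ℝ) →ₗ[ℝ] ℝ)
      (LinearMap.proj a : (Coord → ℝ) →ₗ[ℝ] ℝ)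

/-- The tensor `(x, y, z, w) ↦ B(x, y) C(z, w)`. -/
def tensorBilin (B C : (Coord → ℝ) →ₗ[ℝ] (Coord → ℝ) →ₗ[ℝ] ℝ) :
    (Coord → ℝ) →ₗ[ℝ] (Coord → ℝ) →ₗ[ℝ] (Coord → ℝ) →ₗ[ℝ] (Coord → ℝ) →ₗ[ℝ] ℝ :=
  B.compr₂ (LinearMap.toSpanSingleton ℝ ((Coord → ℝ) →ₗ[ℝ] (Coord → ℝ) →ₗ[ℝ] ℝ) C)

/-- For `{a, b} ≠ {c, d}`, the tensor whose only non-zero components, up to the symmetries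
`A(x,y,z,w) = -A(y,x,z,w) = A(z,w,x,y)`, are `A(e_a, e_b, e_c, e_d) = 1`. -/
def elemCurv (a b c d : Coord) :
    (Coord → ℝ) →ₗ[ℝ] (Coord → ℝ) →ₗ[ℝ] (Coord → ℝ) →ₗ[ℝ] (Coord → ℝ) →ₗ[ℝ] ℝ :=
  tensorBilin (wedge a b) (wedge c d) + tensorBilin (wedge c d) (wedge a b)

theorem elemCurv_apply (a b c d : Coord) (x y z w : Coord → ℝ) :
    elemCurv a b c d x y z w = (x a * y b - x b * y a) * (z c * w d - z d * w c)
      + (x c * y d - x d * y c) * (z a * w b - z b * w a) := by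
  simp [elemCurv, tensorBilin, wedge]

/-- The inner products of the basis vectors of the model. -/
def modelGram : Matrix Coord Coord ℝ
  | .x1, .xs1 | .xs1, .x1 | .x2, .xs2 | .xs2, .x2 | .x3, .xs3 | .xs3, .x3 => 1
  | .y11, .y12 | .y12, .y11 | .y21, .y22 | .y22, .y21 | .y31, .y32 | .y32, .y31 => 1
  | .y41, .y41 | .y42, .y42 => -1 / 2
  | .y41, .y42 | .y42, .y41 => 1 / 4
  | _, _ => 0

/-- The model `𝔐₁₄`, where `α_i`, `α_i^*`, `β_{i,j}` are the standard basis vectors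
of `ℝ^14` with the labels `x_i`, `x_i^*`, `y_{i,j}`. -/
def model14 : ZeroModel (Coord → ℝ) where
  inner := Matrix.toLinearMap₂' ℝ modelGram
  curv :=
    elemCurv .x2 .x1 .x1 .y21 + elemCurv .x3 .x1 .x1 .y31
    + elemCurv .x3 .x2 .x2 .y32 + elemCurv .x1 .x2 .x2 .y12
    + elemCurv .x1 .x3 .x3 .y11 + elemCurv .x2 .x3 .x3 .y22
    + (-1 / 2 : ℝ) • elemCurv .x1 .x2 .x3 .y41 + (-1 / 2 : ℝ) • elemCurv .x1 .x3 .x2 .y41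
    + (-1 / 2 : ℝ) • elemCurv .x2 .x3 .x1 .y42 + (-1 / 2 : ℝ) • elemCurv .x2 .x1 .x3 .y42
  inner_symm x y := by
    simp only [Matrix.toLinearMap₂'_apply, smul_eq_mul, Coord.sum_eq, modelGram]
    ring
  inner_nondeg x hx := by
    have key' : ∀ c, ∑ d, x d * modelGram d c = 0 := by
      intro c
      have := hx (Pi.single c 1)
      simpa [Matrix.toLinearMap₂'_apply, Pi.single_apply] using this
    simp only [Coord.sum_eq] at key'
    have e1 := key' .x1
    have e2 := key' .x2
    have e3 := key' .x3
    have e4 := key' .xs1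
    have e5 := key' .xs2
    have e6 := key' .xs3
    have e7 := key' .y11
    have e8 := key' .y12
    have e9 := key' .y21
    have e10 := key' .y22
    have e11 := key' .y31
    have e12 := key' .y32
    have e13 := key' .y41
    have e14 := key' .y42
    simp only [modelGram, mul_zero, mul_one, add_zero, zero_add]
      at e1 e2 e3 e4 e5 e6 e7 e8 e9 e10 e11 e12 e13 e14
    have f13 : x .y41 = 0 := by linarith
    have f14 : x .y42 = 0 := by linarith
    funext c
    cases c <;> simp only [Pi.zero_apply] <;> assumption
  curv_antisymm x y z w := by
    simp only [LinearMap.add_apply, LinearMap.smul_apply, elemCurv_apply, smul_eq_mul]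
    ring
  curv_pair_symm x y z w := by
    simp only [LinearMap.add_apply, LinearMap.smul_apply, elemCurv_apply, smul_eq_mul]
    ring
  curv_bianchi x y z w := by
    simp only [LinearMap.add_apply, LinearMap.smul_apply, elemCurv_apply, smul_eq_mul]
    ring

end

/-! The metric differs from a constant one only in its x-block, whose entries are quadratic in the x
and y coordinates. Hence `gamma`, the contracted Christoffel symbols, is linear in the point and
takes values without x-components. Products of two Christoffel symbols then land in the
x*-directions, and the curvature at `p` is the model tensor plus `curvQuad`, a form quadratic in `p`
that sees only x-components (`metricForm_curvVec`).

Such an extra term can be removed at each point: shearing the y-directions by x-directions produces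
any curvature tensor in the three x-directions, and shearing the x*-directions restores the inner
products (`exists_equiv_model14`). This gives the 0-model.

For local symmetry, `nablaCurv_eq` writes ∇R as a combination of x-only tensors with coefficients
the defects of the three conditions; each defect can be isolated at one point. -/

/-! ### Partial derivatives and contractions -/

/-- Everything differentiated below is at most quadratic along coordinate lines, so a derivative is
read off as the coefficient of `t` by `ring`. -/
theorem partialD_eq_of_quadratic {ι : Type*} [Fintype ι] [DecidableEq ι] {i : ι}
    {f : (ι → ℝ) → ℝ} {p : ι → ℝ} {d e : ℝ} (hf : DifferentiableAt ℝ f p)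
    (h : ∀ t : ℝ, f (p + t • Pi.single i 1) = f p + t * d + t ^ 2 * e) :
    partialD i f p = d := by
  rw [partialD, ← hf.lineDeriv_eq_fderiv, lineDeriv, funext h]
  have h1 : HasDerivAt (fun t : ℝ => f p + t * d + t ^ 2 * e)
      (0 + 1 * d + (2 : ℕ) * (0 : ℝ) ^ (2 - 1) * e) 0 :=
    (((hasDerivAt_const (0 : ℝ) (f p)).add ((hasDerivAt_id (0 : ℝ)).mul_const d))).add
      ((hasDerivAt_pow 2 (0 : ℝ)).mul_const e)
  rw [h1.deriv]
  norm_num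

/-- Turns index contractions into evaluations at vectors, so that tensor identities become
polynomial identities in arbitrary vectors instead of case checks over 14 labels. -/
theorem IsLinearMap.sum_mul_single {ι : Type*} [Fintype ι] [DecidableEq ι] {f : (ι → ℝ) → ℝ}
    (hf : IsLinearMap ℝ f) (u : ι → ℝ) : ∑ i, u i * f (Pi.single i 1) = f u := by
  have h := (hf.mk' f).pi_apply_eq_sum_univ u
  simp only [IsLinearMap.mk'_apply, smul_eq_mul] at h
  rw [h]
  refine Finset.sum_congr rfl fun i _ => ?_
  congr 2
  funext j
  simp [Pi.single_apply, eq_comm]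

/-! ### Normalising the model by shears -/

/-- Adding to `model14` any multiples of the curvature components in the directions `x_i`, and any
components of the metric in these directions, gives an isomorphic model. -/
theorem exists_equiv_model14 (f₁ f₂ f₃ f₁₂ f₂₃ f₁₃ r₁ r₂ r₃ r₄ r₅ r₆ : ℝ) :
    ∃ Θ : (Coord → ℝ) ≃ₗ[ℝ] (Coord → ℝ),
      (∀ u v, model14.inner (Θ u) (Θ v) = model14.inner u v
        + (f₁ * (u .x1 * v .x1) + f₂ * (u .x2 * v .x2) + f₃ * (u .x3 * v .x3)
          + f₁₂ * (u .x1 * v .x2 + u .x2 * v .x1) + f₂₃ * (u .x2 * v .x3 + u .x3 * v .x2)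
          + f₁₃ * (u .x1 * v .x3 + u .x3 * v .x1))) ∧
      ∀ u v w z, model14.curv (Θ u) (Θ v) (Θ w) (Θ z) = (model14.curv
        + ((1 / 2 * r₁) • elemCurv .x1 .x2 .x1 .x2 + (1 / 2 * r₂) • elemCurv .x1 .x3 .x1 .x3
          + (1 / 2 * r₃) • elemCurv .x2 .x3 .x2 .x3 + r₄ • elemCurv .x1 .x2 .x1 .x3
          + r₅ • elemCurv .x1 .x2 .x2 .x3 + r₆ • elemCurv .x1 .x3 .x2 .x3)) u v w z := by
  -- The y-shifts feed x-components into the curvature terms and create the six `r` terms. The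
  -- y-terms in `.xs2`, `.xs3` cancel the cross terms this causes in the inner product; `r₆ * r₅`
  -- and `r₂ * r₃ / 2` cancel products of two shifts. Each `f` is split evenly by symmetry.
  let θ : (Coord → ℝ) → Coord → ℝ := fun u c => match c with
    | .xs1 => u .xs1 + f₁ / 2 * u .x1 + f₁₂ / 2 * u .x2 + f₁₃ / 2 * u .x3
    | .xs2 => u .xs2 + r₆ * u .y12 + r₁ / 2 * u .y22
        + f₁₂ / 2 * u .x1 + f₂ / 2 * u .x2 + (f₂₃ + r₆ * r₅) / 2 * u .x3
    | .xs3 => u .xs3 + r₄ * u .y22 + r₂ / 2 * u .y32 + r₃ / 2 * u .y31 - r₅ * u .y11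
        + f₁₃ / 2 * u .x1 + (f₂₃ + r₆ * r₅) / 2 * u .x2 + (f₃ - r₂ * r₃ / 2) / 2 * u .x3
    | .y11 => u .y11 - r₆ * u .x2
    | .y12 => u .y12 + r₅ * u .x3
    | .y21 => u .y21 - r₁ / 2 * u .x2 - r₄ * u .x3
    | .y31 => u .y31 - r₂ / 2 * u .x3
    | .y32 => u .y32 - r₃ / 2 * u .x3
    | c => u c
  have hθ : IsLinearMap ℝ θ := by
    refine ⟨fun u v => funext fun c => ?_, fun a u => funext fun c => ?_⟩
    · cases c <;> simp only [θ, Pi.add_apply] <;> ring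
    · cases c <;> simp only [θ, Pi.smul_apply, smul_eq_mul] <;> ring
  -- `θ` is unipotent for the order x, y, x*.
  have hinj : Function.Injective (hθ.mk' θ) := by
    refine (injective_iff_map_eq_zero _).mpr fun u hu => ?_
    have h : ∀ c, θ u c = 0 := fun c => congrFun hu c
    have h1 : u .x1 = 0 := h .x1
    have h2 : u .x2 = 0 := h .x2
    have h3 : u .x3 = 0 := h .x3
    have h11 : u .y11 = 0 := by simpa [θ, h2] using h .y11
    have h12 : u .y12 = 0 := by simpa [θ, h3] using h .y12
    have h21 : u .y21 = 0 := by simpa [θ, h2, h3] using h .y21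
    have h22 : u .y22 = 0 := h .y22
    have h31 : u .y31 = 0 := by simpa [θ, h3] using h .y31
    have h32 : u .y32 = 0 := by simpa [θ, h3] using h .y32
    have hs1 : u .xs1 = 0 := by simpa [θ, h1, h2, h3] using h .xs1
    have hs2 : u .xs2 = 0 := by simpa [θ, h1, h2, h3, h12, h22] using h .xs2
    have hs3 : u .xs3 = 0 := by simpa [θ, h1, h2, h3, h22, h32, h31, h11] using h .xs3
    funext c
    cases c <;> first | assumption | exact h .y41 | exact h .y42
  refine ⟨LinearEquiv.ofInjectiveEndo (hθ.mk' θ) hinj, fun u v => ?_, fun u v w z => ?_⟩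
  · change model14.inner (θ u) (θ v) = _
    simp only [model14, Matrix.toLinearMap₂'_apply, smul_eq_mul, Coord.sum_eq, modelGram, mul_zero,
      add_zero, zero_add, θ]
    ring
  · change model14.curv (θ u) (θ v) (θ w) (θ z) = _
    simp only [model14, LinearMap.add_apply, LinearMap.smul_apply, elemCurv_apply, smul_eq_mul, θ]
    ring

/-! ### The metric and its Christoffel symbols -/

noncomputable section

variable (a₁₁ a₁₂ a₂₁ a₂₂ a₃₁ a₃₂ : ℝ)

/-- The form `g_p(u, v)` written out in coordinates. -/
def metricForm (p u v : Coord → ℝ) : ℝ :=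
  (-2 * a₂₁ * p .x2 * p .y21 - 2 * a₃₁ * p .x3 * p .y31) * (u .x1 * v .x1)
  + (-2 * a₃₂ * p .x3 * p .y32 - 2 * a₁₂ * p .x1 * p .y12) * (u .x2 * v .x2)
  + (-2 * a₁₁ * p .x1 * p .y11 - 2 * a₂₂ * p .x2 * p .y22) * (u .x3 * v .x3)
  + (2 * (1 - a₂₁) * p .x1 * p .y21 + 2 * (1 - a₁₂) * p .x2 * p .y12)
    * (u .x1 * v .x2 + u .x2 * v .x1)
  + (p .x1 * p .y41 + 2 * (1 - a₃₂) * p .x2 * p .y32 + 2 * (1 - a₂₂) * p .x3 * p .y22)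
    * (u .x2 * v .x3 + u .x3 * v .x2)
  + (p .x2 * p .y42 + 2 * (1 - a₃₁) * p .x1 * p .y31 + 2 * (1 - a₁₁) * p .x3 * p .y11)
    * (u .x1 * v .x3 + u .x3 * v .x1)
  + (u .x1 * v .xs1 + u .xs1 * v .x1) + (u .x2 * v .xs2 + u .xs2 * v .x2)
  + (u .x3 * v .xs3 + u .xs3 * v .x3) + (u .y11 * v .y12 + u .y12 * v .y11)
  + (u .y21 * v .y22 + u .y22 * v .y21) + (u .y31 * v .y32 + u .y32 * v .y31)
  - 1 / 2 * (u .y41 * v .y41) - 1 / 2 * (u .y42 * v .y42)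
  + 1 / 4 * (u .y41 * v .y42 + u .y42 * v .y41)

/-- The derivative of `p ↦ g_p(u, v)` in the direction `t`. -/
def metricFormDeriv (p t u v : Coord → ℝ) : ℝ :=
  (-2 * a₂₁ * (p .x2 * t .y21 + t .x2 * p .y21) - 2 * a₃₁ * (p .x3 * t .y31 + t .x3 * p .y31))
    * (u .x1 * v .x1)
  + (-2 * a₃₂ * (p .x3 * t .y32 + t .x3 * p .y32) - 2 * a₁₂ * (p .x1 * t .y12 + t .x1 * p .y12))
    * (u .x2 * v .x2)
  + (-2 * a₁₁ * (p .x1 * t .y11 + t .x1 * p .y11) - 2 * a₂₂ * (p .x2 * t .y22 + t .x2 * p .y22))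
    * (u .x3 * v .x3)
  + (2 * (1 - a₂₁) * (p .x1 * t .y21 + t .x1 * p .y21)
      + 2 * (1 - a₁₂) * (p .x2 * t .y12 + t .x2 * p .y12)) * (u .x1 * v .x2 + u .x2 * v .x1)
  + ((p .x1 * t .y41 + t .x1 * p .y41) + 2 * (1 - a₃₂) * (p .x2 * t .y32 + t .x2 * p .y32)
      + 2 * (1 - a₂₂) * (p .x3 * t .y22 + t .x3 * p .y22)) * (u .x2 * v .x3 + u .x3 * v .x2)
  + ((p .x2 * t .y42 + t .x2 * p .y42) + 2 * (1 - a₃₁) * (p .x1 * t .y31 + t .x1 * p .y31)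
      + 2 * (1 - a₁₁) * (p .x3 * t .y11 + t .x3 * p .y11)) * (u .x1 * v .x3 + u .x3 * v .x1)

theorem metricAt_metricA (p u v : Coord → ℝ) :
    (metricA a₁₁ a₁₂ a₂₁ a₂₂ a₃₁ a₃₂).metricAt p u v
      = metricForm a₁₁ a₁₂ a₂₁ a₂₂ a₃₁ a₃₂ p u v := by
  simp only [PseudoRiemannianMetric.metricAt, metricA, Coord.sum_eq, metricMatrix, metricForm,
    zero_mul, add_zero, zero_add]
  ring

theorem comp_metricA (p : Coord → ℝ) (i j : Coord) :
    (metricA a₁₁ a₁₂ a₂₁ a₂₂ a₃₁ a₃₂).comp p i j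
      = metricForm a₁₁ a₁₂ a₂₁ a₂₂ a₃₁ a₃₂ p (Pi.single i 1) (Pi.single j 1) := by
  rw [← metricAt_metricA]
  simp [PseudoRiemannianMetric.metricAt, Pi.single_apply]

theorem isLinearMap_metricForm (p v : Coord → ℝ) :
    IsLinearMap ℝ fun u => metricForm a₁₁ a₁₂ a₂₁ a₂₂ a₃₁ a₃₂ p u v where
  map_add _ _ := by simp only [metricForm, Pi.add_apply]; ring
  map_smul _ _ := by simp only [metricForm, Pi.smul_apply, smul_eq_mul]; ring

theorem partialD_comp_metricA (p : Coord → ℝ) (k i j : Coord) :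
    partialD k (fun q => (metricA a₁₁ a₁₂ a₂₁ a₂₂ a₃₁ a₃₂).comp q i j) p
      = metricFormDeriv a₁₁ a₁₂ a₂₁ a₂₂ a₃₁ a₃₂ p (Pi.single k 1) (Pi.single i 1)
          (Pi.single j 1) := by
  refine partialD_eq_of_quadratic
    -- In the point, the form is a quadratic part plus a constant; subtracting the value at `0`
    -- leaves the quadratic part at the direction of differentiation.
    (e := metricForm a₁₁ a₁₂ a₂₁ a₂₂ a₃₁ a₃₂ (Pi.single k 1) (Pi.single i 1) (Pi.single j 1)
      - metricForm a₁₁ a₁₂ a₂₁ a₂₂ a₃₁ a₃₂ 0 (Pi.single i 1) (Pi.single j 1))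
    (((metricA a₁₁ a₁₂ a₂₁ a₂₂ a₃₁ a₃₂).smooth i j).differentiable (by simp) p) fun t => ?_
  simp only [comp_metricA]
  generalize (Pi.single i 1 : Coord → ℝ) = u
  generalize (Pi.single j 1 : Coord → ℝ) = v
  simp only [metricForm, metricFormDeriv, Pi.add_apply, Pi.smul_apply, smul_eq_mul, Pi.zero_apply]
  ring

/-- The Christoffel symbols contracted with `u` and `v`: the vector `∇_u V` at `p`, where `V` is the
constant extension of `v`. -/
def gamma (p u v : Coord → ℝ) : Coord → ℝ
  | .xs1 =>
      (-a₂₁ * p .y21) * (u .x1 * v .x2 + u .x2 * v .x1)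
      + (-a₃₁ * p .y31) * (u .x1 * v .x3 + u .x3 * v .x1)
      + (-a₂₁ * p .x2) * (u .x1 * v .y21 + u .y21 * v .x1)
      + (-a₃₁ * p .x3) * (u .x1 * v .y31 + u .y31 * v .x1)
      + (2 * p .y12 - a₁₂ * p .y12) * u .x2 * v .x2
      + (1/2 * p .y42 + (-1/2) * p .y41) * (u .x2 * v .x3 + u .x3 * v .x2)
      + (p .x2 - a₁₂ * p .x2) * (u .x2 * v .y12 + u .y12 * v .x2)
      + (p .x1 - a₂₁ * p .x1) * (u .x2 * v .y21 + u .y21 * v .x2)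
      + (2 * p .y11 - a₁₁ * p .y11) * u .x3 * v .x3
      + (p .x3 - a₁₁ * p .x3) * (u .x3 * v .y11 + u .y11 * v .x3)
      + (p .x1 - a₃₁ * p .x1) * (u .x3 * v .y31 + u .y31 * v .x3)
      + (1/2 * p .x2) * (u .x3 * v .y42 + u .y42 * v .x3)
  | .xs2 =>
      (2 * p .y21 - a₂₁ * p .y21) * u .x1 * v .x1
      + (-a₁₂ * p .y12) * (u .x1 * v .x2 + u .x2 * v .x1)
      + (1/2 * p .y41 + (-1/2) * p .y42) * (u .x1 * v .x3 + u .x3 * v .x1)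
      + (p .x2 - a₁₂ * p .x2) * (u .x1 * v .y12 + u .y12 * v .x1)
      + (p .x1 - a₂₁ * p .x1) * (u .x1 * v .y21 + u .y21 * v .x1)
      + (-a₃₂ * p .y32) * (u .x2 * v .x3 + u .x3 * v .x2)
      + (-a₁₂ * p .x1) * (u .x2 * v .y12 + u .y12 * v .x2)
      + (-a₃₂ * p .x3) * (u .x2 * v .y32 + u .y32 * v .x2)
      + (2 * p .y22 - a₂₂ * p .y22) * u .x3 * v .x3
      + (p .x3 - a₂₂ * p .x3) * (u .x3 * v .y22 + u .y22 * v .x3)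
      + (p .x2 - a₃₂ * p .x2) * (u .x3 * v .y32 + u .y32 * v .x3)
      + (1/2 * p .x1) * (u .x3 * v .y41 + u .y41 * v .x3)
  | .xs3 =>
      (2 * p .y31 - a₃₁ * p .y31) * u .x1 * v .x1
      + (1/2 * p .y41 + 1/2 * p .y42) * (u .x1 * v .x2 + u .x2 * v .x1)
      + (-a₁₁ * p .y11) * (u .x1 * v .x3 + u .x3 * v .x1)
      + (p .x3 - a₁₁ * p .x3) * (u .x1 * v .y11 + u .y11 * v .x1)
      + (p .x1 - a₃₁ * p .x1) * (u .x1 * v .y31 + u .y31 * v .x1)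
      + (1/2 * p .x2) * (u .x1 * v .y42 + u .y42 * v .x1)
      + (2 * p .y32 - a₃₂ * p .y32) * u .x2 * v .x2
      + (-a₂₂ * p .y22) * (u .x2 * v .x3 + u .x3 * v .x2)
      + (p .x3 - a₂₂ * p .x3) * (u .x2 * v .y22 + u .y22 * v .x2)
      + (p .x2 - a₃₂ * p .x2) * (u .x2 * v .y32 + u .y32 * v .x2)
      + (1/2 * p .x1) * (u .x2 * v .y41 + u .y41 * v .x2)
      + (-a₁₁ * p .x1) * (u .x3 * v .y11 + u .y11 * v .x3)
      + (-a₂₂ * p .x2) * (u .x3 * v .y22 + u .y22 * v .x3)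
  | .y11 =>
      (-p .x2 + a₁₂ * p .x2) * (u .x1 * v .x2 + u .x2 * v .x1)
      + (a₁₂ * p .x1) * u .x2 * v .x2
  | .y12 =>
      (-p .x3 + a₁₁ * p .x3) * (u .x1 * v .x3 + u .x3 * v .x1)
      + (a₁₁ * p .x1) * u .x3 * v .x3
  | .y21 =>
      (-p .x3 + a₂₂ * p .x3) * (u .x2 * v .x3 + u .x3 * v .x2)
      + (a₂₂ * p .x2) * u .x3 * v .x3
  | .y22 =>
      (a₂₁ * p .x2) * u .x1 * v .x1
      + (-p .x1 + a₂₁ * p .x1) * (u .x1 * v .x2 + u .x2 * v .x1)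
  | .y31 =>
      (a₃₂ * p .x3) * u .x2 * v .x2
      + (-p .x2 + a₃₂ * p .x2) * (u .x2 * v .x3 + u .x3 * v .x2)
  | .y32 =>
      (a₃₁ * p .x3) * u .x1 * v .x1
      + (-p .x1 + a₃₁ * p .x1) * (u .x1 * v .x3 + u .x3 * v .x1)
  -- The 2/3 and 4/3 come from inverting the Gram block with entries -1/2 and 1/4.
  | .y41 =>
      (2/3 * p .x2) * (u .x1 * v .x3 + u .x3 * v .x1)
      + (4/3 * p .x1) * (u .x2 * v .x3 + u .x3 * v .x2)
  | .y42 =>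
      (4/3 * p .x2) * (u .x1 * v .x3 + u .x3 * v .x1)
      + (2/3 * p .x1) * (u .x2 * v .x3 + u .x3 * v .x2)
  | _ => 0

/-- The Koszul formula for constant fields. Checking it with the index lowered avoids computing the
inverse metric; non-degeneracy then identifies `gamma` in `christoffel_metricA`. -/
theorem metricForm_gamma (p u v w : Coord → ℝ) :
    metricForm a₁₁ a₁₂ a₂₁ a₂₂ a₃₁ a₃₂ p (gamma a₁₁ a₁₂ a₂₁ a₂₂ a₃₁ a₃₂ p u v) w
      = (metricFormDeriv a₁₁ a₁₂ a₂₁ a₂₂ a₃₁ a₃₂ p u v w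
        + metricFormDeriv a₁₁ a₁₂ a₂₁ a₂₂ a₃₁ a₃₂ p v u w
        - metricFormDeriv a₁₁ a₁₂ a₂₁ a₂₂ a₃₁ a₃₂ p w u v) / 2 := by
  simp only [metricForm, metricFormDeriv, gamma]
  ring

theorem isLinearMap_gamma (p u : Coord → ℝ) (k : Coord) :
    IsLinearMap ℝ fun v => gamma a₁₁ a₁₂ a₂₁ a₂₂ a₃₁ a₃₂ p u v k where
  map_add _ _ := by cases k <;> simp only [gamma, Pi.add_apply] <;> ring
  map_smul _ _ := by cases k <;> simp only [gamma, Pi.smul_apply, smul_eq_mul] <;> ring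

theorem christoffel_metricA (p : Coord → ℝ) (i j k : Coord) :
    (metricA a₁₁ a₁₂ a₂₁ a₂₂ a₃₁ a₃₂).christoffel p i j k
      = gamma a₁₁ a₁₂ a₂₁ a₂₂ a₃₁ a₃₂ p (Pi.single i 1) (Pi.single j 1) k := by
  set c := gamma a₁₁ a₁₂ a₂₁ a₂₂ a₃₁ a₃₂ p (Pi.single i 1) (Pi.single j 1) with hc
  have h : ∀ l, (partialD i (fun q => (metricA a₁₁ a₁₂ a₂₁ a₂₂ a₃₁ a₃₂).comp q j l) p
      + partialD j (fun q => (metricA a₁₁ a₁₂ a₂₁ a₂₂ a₃₁ a₃₂).comp q i l) p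
      - partialD l (fun q => (metricA a₁₁ a₁₂ a₂₁ a₂₂ a₃₁ a₃₂).comp q i j) p) / 2
      = ((metricA a₁₁ a₁₂ a₂₁ a₂₂ a₃₁ a₃₂).comp p).mulVec c l := by
    intro l
    simp only [partialD_comp_metricA]
    rw [← metricForm_gamma, ← hc, ← (isLinearMap_metricForm ..).sum_mul_single c]
    simp only [← comp_metricA, Matrix.mulVec, dotProduct]
    exact Finset.sum_congr rfl fun m _ => by
      rw [(metricA a₁₁ a₁₂ a₂₁ a₂₂ a₃₁ a₃₂).symm p m l, mul_comm]
  simp only [PseudoRiemannianMetric.christoffel, h]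
  change (((metricA a₁₁ a₁₂ a₂₁ a₂₂ a₃₁ a₃₂).comp p)⁻¹.mulVec
    (((metricA a₁₁ a₁₂ a₂₁ a₂₂ a₃₁ a₃₂).comp p).mulVec c)) k = c k
  rw [Matrix.mulVec_mulVec, Matrix.nonsing_inv_mul _
    (isUnit_iff_ne_zero.mpr ((metricA a₁₁ a₁₂ a₂₁ a₂₂ a₃₁ a₃₂).det_ne_zero p)), Matrix.one_mulVec]

/-- Since `gamma` is linear in the point, its derivative is its value at the direction. -/
theorem partialD_christoffel_metricA (p : Coord → ℝ) (m i j k : Coord) :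
    partialD m (fun q => (metricA a₁₁ a₁₂ a₂₁ a₂₂ a₃₁ a₃₂).christoffel q i j k) p
      = gamma a₁₁ a₁₂ a₂₁ a₂₂ a₃₁ a₃₂ (Pi.single m 1) (Pi.single i 1) (Pi.single j 1) k := by
  simp only [christoffel_metricA]
  generalize (Pi.single i 1 : Coord → ℝ) = u
  generalize (Pi.single j 1 : Coord → ℝ) = v
  refine partialD_eq_of_quadratic (e := 0) ?_ fun t => ?_
  · cases k <;> simp only [gamma] <;> fun_prop
  · generalize (Pi.single m 1 : Coord → ℝ) = w
    cases k <;> simp only [gamma, Pi.add_apply, Pi.smul_apply, smul_eq_mul] <;> ring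

/-! ### The curvature tensor -/

/-- The curvature operator `R(u, v) w` at `p`, in terms of the contracted Christoffel symbols. -/
def curvVec (p u v w : Coord → ℝ) (l : Coord) : ℝ :=
  gamma a₁₁ a₁₂ a₂₁ a₂₂ a₃₁ a₃₂ u v w l - gamma a₁₁ a₁₂ a₂₁ a₂₂ a₃₁ a₃₂ v u w l
  + (gamma a₁₁ a₁₂ a₂₁ a₂₂ a₃₁ a₃₂ p u (gamma a₁₁ a₁₂ a₂₁ a₂₂ a₃₁ a₃₂ p v w) l
    - gamma a₁₁ a₁₂ a₂₁ a₂₂ a₃₁ a₃₂ p v (gamma a₁₁ a₁₂ a₂₁ a₂₂ a₃₁ a₃₂ p u w) l)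

theorem curvOp_metricA (p : Coord → ℝ) (i j k l : Coord) :
    (metricA a₁₁ a₁₂ a₂₁ a₂₂ a₃₁ a₃₂).curvOp p i j k l
      = curvVec a₁₁ a₁₂ a₂₁ a₂₂ a₃₁ a₃₂ p (Pi.single i 1) (Pi.single j 1) (Pi.single k 1) l := by
  simp only [PseudoRiemannianMetric.curvOp, partialD_christoffel_metricA]
  simp only [christoffel_metricA, Finset.sum_sub_distrib]
  rw [(isLinearMap_gamma a₁₁ a₁₂ a₂₁ a₂₂ a₃₁ a₃₂ p (Pi.single i 1) l).sum_mul_single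
      (gamma a₁₁ a₁₂ a₂₁ a₂₂ a₃₁ a₃₂ p (Pi.single j 1) (Pi.single k 1)),
    (isLinearMap_gamma a₁₁ a₁₂ a₂₁ a₂₂ a₃₁ a₃₂ p (Pi.single j 1) l).sum_mul_single
      (gamma a₁₁ a₁₂ a₂₁ a₂₂ a₃₁ a₃₂ p (Pi.single i 1) (Pi.single k 1)), curvVec]

/-- The polarization in `p` of the part of the curvature tensor that depends on the point `p`. -/
def curvQuad (p t : Coord → ℝ) :
    (Coord → ℝ) →ₗ[ℝ] (Coord → ℝ) →ₗ[ℝ] (Coord → ℝ) →ₗ[ℝ] (Coord → ℝ) →ₗ[ℝ] ℝ :=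
  (1 / 2 * (a₃₁ * a₃₂ * (p .x3 * t .x3))) • elemCurv .x1 .x2 .x1 .x2
  + (1 / 2 * ((2 / 3 + a₂₁ * a₂₂) * (p .x2 * t .x2))) • elemCurv .x1 .x3 .x1 .x3
  + (1 / 2 * ((2 / 3 + a₁₁ * a₁₂) * (p .x1 * t .x1))) • elemCurv .x2 .x3 .x2 .x3
  + ((-1 + a₁₁ - a₁₁ * a₁₂ + a₁₂ - a₂₁ + a₂₁ * a₂₂ - a₃₁ + a₃₁ * a₃₂)
      * ((p .x2 * t .x3 + p .x3 * t .x2) / 2)) • elemCurv .x1 .x2 .x1 .x3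
  + ((1 - a₁₁ * a₁₂ + a₁₂ - a₂₁ + a₂₁ * a₂₂ - a₂₂ - a₃₁ * a₃₂ + a₃₂)
      * ((p .x1 * t .x3 + p .x3 * t .x1) / 2)) • elemCurv .x1 .x2 .x2 .x3
  + ((-2 / 3 - a₁₁ + a₁₁ * a₁₂ + a₂₁ * a₂₂ - a₂₂ + a₃₁ - a₃₁ * a₃₂ + a₃₂)
      * ((p .x1 * t .x2 + p .x2 * t .x1) / 2)) • elemCurv .x1 .x3 .x2 .x3

/-- The derivative terms of `curvVec` give the constant model tensor and the products of Christoffel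
symbols give the quadratic part. As `curvVec` has no x-components, the variable entries of the
metric do not contribute. -/
theorem metricForm_curvVec (p u v w z : Coord → ℝ) :
    metricForm a₁₁ a₁₂ a₂₁ a₂₂ a₃₁ a₃₂ p (curvVec a₁₁ a₁₂ a₂₁ a₂₂ a₃₁ a₃₂ p u v w) z
      = (model14.curv + curvQuad a₁₁ a₁₂ a₂₁ a₂₂ a₃₁ a₃₂ p p) u v w z := by
  simp only [metricForm, curvVec, gamma, model14, curvQuad, LinearMap.add_apply,
    LinearMap.smul_apply, elemCurv_apply, smul_eq_mul, mul_zero, zero_mul, add_zero, zero_add,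
    sub_zero]
  ring

theorem curvComp_metricA (p : Coord → ℝ) (i j k l : Coord) :
    (metricA a₁₁ a₁₂ a₂₁ a₂₂ a₃₁ a₃₂).curvComp p i j k l
      = (model14.curv + curvQuad a₁₁ a₁₂ a₂₁ a₂₂ a₃₁ a₃₂ p p)
          (Pi.single i 1) (Pi.single j 1) (Pi.single k 1) (Pi.single l 1) := by
  simp only [PseudoRiemannianMetric.curvComp, curvOp_metricA, comp_metricA]
  rw [← metricForm_curvVec]
  exact (isLinearMap_metricForm a₁₁ a₁₂ a₂₁ a₂₂ a₃₁ a₃₂ p _).sum_mul_single _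

theorem curvAt_metricA (p u v w z : Coord → ℝ) :
    (metricA a₁₁ a₁₂ a₂₁ a₂₂ a₃₁ a₃₂).curvAt p u v w z
      = (model14.curv + curvQuad a₁₁ a₁₂ a₂₁ a₂₂ a₃₁ a₃₂ p p) u v w z := by
  simp only [PseudoRiemannianMetric.curvAt, curvComp_metricA]
  generalize model14.curv + curvQuad a₁₁ a₁₂ a₂₁ a₂₂ a₃₁ a₃₂ p p = T
  have h₁ := IsLinearMap.sum_mul_single (f := fun u => T u v w z) ⟨by simp, by simp⟩ u
  have h₂ := fun u => IsLinearMap.sum_mul_single (f := fun v => T u v w z) ⟨by simp, by simp⟩ v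
  have h₃ := fun u v => IsLinearMap.sum_mul_single (f := fun w => T u v w z) ⟨by simp, by simp⟩ w
  have h₄ := fun u v w => IsLinearMap.sum_mul_single (f := fun z => T u v w z) ⟨by simp, by simp⟩ z
  simp only [← h₁, ← h₂, ← h₃, ← h₄, Finset.mul_sum]
  refine Finset.sum_congr rfl fun i _ => Finset.sum_congr rfl fun j _ =>
    Finset.sum_congr rfl fun k _ => Finset.sum_congr rfl fun l _ => ?_
  ring

/-! ### The 0-model at every point -/

theorem hasZeroModel_metricA : (metricA a₁₁ a₁₂ a₂₁ a₂₂ a₃₁ a₃₂).HasZeroModel model14 := by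
  intro p
  -- The six curvature parameters stay open until the last line, where unification takes them from
  -- `curvQuad`.
  obtain ⟨Θ, hΘ, hΘ'⟩ := exists_equiv_model14
    (-2 * a₂₁ * p .x2 * p .y21 - 2 * a₃₁ * p .x3 * p .y31)
    (-2 * a₃₂ * p .x3 * p .y32 - 2 * a₁₂ * p .x1 * p .y12)
    (-2 * a₁₁ * p .x1 * p .y11 - 2 * a₂₂ * p .x2 * p .y22)
    (2 * (1 - a₂₁) * p .x1 * p .y21 + 2 * (1 - a₁₂) * p .x2 * p .y12)
    (p .x1 * p .y41 + 2 * (1 - a₃₂) * p .x2 * p .y32 + 2 * (1 - a₂₂) * p .x3 * p .y22)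
    (p .x2 * p .y42 + 2 * (1 - a₃₁) * p .x1 * p .y31 + 2 * (1 - a₁₁) * p .x3 * p .y11) _ _ _ _ _ _
  refine ⟨Θ, fun u v => ?_, fun u v w z => ?_⟩
  · rw [hΘ, metricAt_metricA]
    simp only [model14, Matrix.toLinearMap₂'_apply, smul_eq_mul, Coord.sum_eq, modelGram, mul_zero,
      add_zero, zero_add, metricForm]
    ring
  · rw [curvAt_metricA, hΘ', curvQuad]

/-! ### Local symmetry -/

/-- The covariant derivative `(∇_t R)(u, v, w, z)` at `p`. -/
def nablaCurv (p t u v w z : Coord → ℝ) : ℝ :=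
  2 * curvQuad a₁₁ a₁₂ a₂₁ a₂₂ a₃₁ a₃₂ p t u v w z
  - ((model14.curv + curvQuad a₁₁ a₁₂ a₂₁ a₂₂ a₃₁ a₃₂ p p)
        (gamma a₁₁ a₁₂ a₂₁ a₂₂ a₃₁ a₃₂ p t u) v w z
    + (model14.curv + curvQuad a₁₁ a₁₂ a₂₁ a₂₂ a₃₁ a₃₂ p p)
        u (gamma a₁₁ a₁₂ a₂₁ a₂₂ a₃₁ a₃₂ p t v) w z
    + (model14.curv + curvQuad a₁₁ a₁₂ a₂₁ a₂₂ a₃₁ a₃₂ p p)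
        u v (gamma a₁₁ a₁₂ a₂₁ a₂₂ a₃₁ a₃₂ p t w) z
    + (model14.curv + curvQuad a₁₁ a₁₂ a₂₁ a₂₂ a₃₁ a₃₂ p p)
        u v w (gamma a₁₁ a₁₂ a₂₁ a₂₂ a₃₁ a₃₂ p t z))

/-- The model part is constant, and a quadratic form differentiates to twice its polarization. -/
theorem partialD_curvComp_metricA (p : Coord → ℝ) (m i j k l : Coord) :
    partialD m (fun q => (metricA a₁₁ a₁₂ a₂₁ a₂₂ a₃₁ a₃₂).curvComp q i j k l) p
      = 2 * curvQuad a₁₁ a₁₂ a₂₁ a₂₂ a₃₁ a₃₂ p (Pi.single m 1)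
          (Pi.single i 1) (Pi.single j 1) (Pi.single k 1) (Pi.single l 1) := by
  simp only [curvComp_metricA, LinearMap.add_apply]
  generalize (Pi.single i 1 : Coord → ℝ) = u
  generalize (Pi.single j 1 : Coord → ℝ) = v
  generalize (Pi.single k 1 : Coord → ℝ) = w
  generalize (Pi.single l 1 : Coord → ℝ) = z
  refine partialD_eq_of_quadratic (e := curvQuad a₁₁ a₁₂ a₂₁ a₂₂ a₃₁ a₃₂ (Pi.single m 1)
    (Pi.single m 1) u v w z) ?_ fun t => ?_
  · simp only [curvQuad, LinearMap.add_apply, LinearMap.smul_apply, smul_eq_mul]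
    fun_prop
  · generalize (Pi.single m 1 : Coord → ℝ) = s
    simp only [curvQuad, LinearMap.add_apply, LinearMap.smul_apply, smul_eq_mul, Pi.add_apply,
      Pi.smul_apply]
    ring

theorem nablaCurvComp_metricA (p : Coord → ℝ) (i j k l m : Coord) :
    (metricA a₁₁ a₁₂ a₂₁ a₂₂ a₃₁ a₃₂).nablaCurvComp p i j k l m
      = nablaCurv a₁₁ a₁₂ a₂₁ a₂₂ a₃₁ a₃₂ p (Pi.single m 1) (Pi.single i 1) (Pi.single j 1)
          (Pi.single k 1) (Pi.single l 1) := by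
  simp only [PseudoRiemannianMetric.nablaCurvComp, partialD_curvComp_metricA]
  simp only [nablaCurv, curvComp_metricA, christoffel_metricA, Finset.sum_add_distrib]
  generalize model14.curv + curvQuad a₁₁ a₁₂ a₂₁ a₂₂ a₃₁ a₃₂ p p = T
  congr 1
  congr 1
  · congr 1
    · congr 1
      · exact IsLinearMap.sum_mul_single (f := fun u => T u (Pi.single j 1) (Pi.single k 1)
          (Pi.single l 1)) ⟨by simp, by simp⟩ _
      · exact IsLinearMap.sum_mul_single (f := fun u => T (Pi.single i 1) u (Pi.single k 1)
          (Pi.single l 1)) ⟨by simp, by simp⟩ _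
    · exact IsLinearMap.sum_mul_single (f := fun u => T (Pi.single i 1) (Pi.single j 1) u
        (Pi.single l 1)) ⟨by simp, by simp⟩ _
  · exact IsLinearMap.sum_mul_single (f := fun u => T (Pi.single i 1) (Pi.single j 1)
      (Pi.single k 1) u) ⟨by simp, by simp⟩ _

/-- `curvQuad` vanishes on values of `gamma`, so only the model tensor on their y-components enters
the correction terms. These are linear in `p` and see only x-components, like the derivative of
`curvQuad`. -/
theorem nablaCurv_eq (p t u v w z : Coord → ℝ) :
    nablaCurv a₁₁ a₁₂ a₂₁ a₂₂ a₃₁ a₃₂ p t u v w z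
      = (a₁₁ + a₂₂ + a₃₁ * a₃₂ - 2) *
          ((p .x3 * t .x3) • elemCurv .x1 .x2 .x1 .x2
            + (p .x3 * t .x2 + p .x2 * t .x3) • elemCurv .x1 .x2 .x1 .x3
            + (-(p .x3 * t .x1 + p .x1 * t .x3)) • elemCurv .x1 .x2 .x2 .x3
            + (-(p .x2 * t .x1 + p .x1 * t .x2)) • elemCurv .x1 .x3 .x2 .x3) u v w z
        + (a₂₁ + a₃₁ + a₁₂ * a₁₁ - 4 / 3) *
          ((p .x1 * t .x1) • elemCurv .x2 .x3 .x2 .x3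
            + (-(p .x3 * t .x2 + p .x2 * t .x3)) • elemCurv .x1 .x2 .x1 .x3
            + (-(p .x3 * t .x1 + p .x1 * t .x3)) • elemCurv .x1 .x2 .x2 .x3
            + (p .x2 * t .x1 + p .x1 * t .x2) • elemCurv .x1 .x3 .x2 .x3) u v w z
        + (a₁₂ + a₃₂ + a₂₁ * a₂₂ - 4 / 3) *
          ((p .x2 * t .x2) • elemCurv .x1 .x3 .x1 .x3
            + (p .x3 * t .x2 + p .x2 * t .x3) • elemCurv .x1 .x2 .x1 .x3
            + (p .x3 * t .x1 + p .x1 * t .x3) • elemCurv .x1 .x2 .x2 .x3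
            + (p .x2 * t .x1 + p .x1 * t .x2) • elemCurv .x1 .x3 .x2 .x3) u v w z := by
  simp only [nablaCurv, gamma, model14, curvQuad, LinearMap.add_apply,
    LinearMap.smul_apply, elemCurv_apply, smul_eq_mul, mul_zero, zero_mul]
  ring

theorem isLocallySymmetric_metricA_iff :
    (metricA a₁₁ a₁₂ a₂₁ a₂₂ a₃₁ a₃₂).IsLocallySymmetric ↔
      (a₁₁ + a₂₂ + a₃₁ * a₃₂ = 2 ∧
        3 * a₂₁ + 3 * a₃₁ + 3 * a₁₂ * a₁₁ = 4 ∧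
        3 * a₁₂ + 3 * a₃₂ + 3 * a₂₁ * a₂₂ = 4) := by
  simp only [PseudoRiemannianMetric.IsLocallySymmetric, nablaCurvComp_metricA, nablaCurv_eq]
  constructor
  · intro h
    -- Each of the sectional-type tensors, such as `elemCurv .x1 .x2 .x1 .x2`, occurs with only one
    -- of the three defects; differentiating at a unit vector in its own direction isolates that
    -- defect.
    have h₁ := h (Pi.single .x3 1) .x1 .x2 .x1 .x2 .x3
    have h₂ := h (Pi.single .x1 1) .x2 .x3 .x2 .x3 .x1
    have h₃ := h (Pi.single .x2 1) .x1 .x3 .x1 .x3 .x2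
    simp [elemCurv_apply] at h₁ h₂ h₃
    exact ⟨by linarith, by linarith, by linarith⟩
  · rintro ⟨h₁, h₂, h₃⟩ p i j k l m
    rw [show a₁₁ + a₂₂ + a₃₁ * a₃₂ - 2 = 0 by linarith,
      show a₂₁ + a₃₁ + a₁₂ * a₁₁ - 4 / 3 = 0 by linarith,
      show a₁₂ + a₃₂ + a₂₁ * a₂₂ - 4 / 3 = 0 by linarith]
    ring

end

theorem theorem1p9 (a₁₁ a₁₂ a₂₁ a₂₂ a₃₁ a₃₂ : ℝ) :
    (metricA a₁₁ a₁₂ a₂₁ a₂₂ a₃₁ a₃₂).HasZeroModel model14 ∧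
    ((metricA a₁₁ a₁₂ a₂₁ a₂₂ a₃₁ a₃₂).IsLocallySymmetric ↔
      (a₁₁ + a₂₂ + a₃₁ * a₃₂ = 2 ∧
        3 * a₂₁ + 3 * a₃₁ + 3 * a₁₂ * a₁₁ = 4 ∧
        3 * a₁₂ + 3 * a₃₂ + 3 * a₂₁ * a₂₂ = 4)) :=
  ⟨hasZeroModel_metricA a₁₁ a₁₂ a₂₁ a₂₂ a₃₁ a₃₂,
    isLocallySymmetric_metricA_iff a₁₁ a₁₂ a₂₁ a₂₂ a₃₁ a₃₂⟩
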